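/- Let $d\ge 1$ and let $p(x,y)$, $x,y\in\mathbb Z^d$, be an irreducible, translation invariant transition probability on $\mathbb Z^d$. For $\alpha,\beta,k\in\mathbb N=\{0,1,2,\dots\}$ let $g^k_{\alpha,\beta}\ge 0$ be rates with $g^k_{\alpha,\beta}=0$ if $k=0$, $k>\alpha$ or $\alpha=0$. Assume that the total rates are bounded: there is a constant $C<\infty$ such that $$\sum_{k\le\alpha} g^k_{\alpha,\beta}\le C\qquad\text{for all }\alpha,\beta\ge 0 .$$ Let $a:\mathbb Z^d\to(0,\infty)$ satisfy $\sum_x a_x<\infty$ and, for some constant $M$, $\sum_y p(x,y)a_y+\sum_y a_y p(y,x)\le M a_x$ for all $x$; write $\|\eta-\zeta\|=\sum_x|\eta(x)-\zeta(x)|a_x\in[0,\infty]$ for $\eta,\zeta\in\mathbb N^{\mathbb Z^d}$. The mass migration process has the generator $$\mathcal L f(\eta)=\sum_{x,y}\sum_{k>0}p(x,y)\,g^k_{\eta(x),\eta(y)}\bigl(f(S^k_{x,y}\eta)-f(\eta)\bigr),$$ where, if $\eta(x)\ge k$, $S^k_{x,y}\eta$ is obtained from $\eta$ by moving $k$ particles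 from $x$ to $y$ (so $S^k_{x,x}\eta=\eta$). Let $(S(t))_{t\ge0}$ be a Markov semigroup with generator $\mathcal L$, that is, a semigroup given by Markov transition kernels on a measurable state space $\Omega\subseteq\mathbb N^{\mathbb Z^d}$ such that $(S(t)f-f)/t\to\mathcal L f$ pointwise on $\Omega$ as $t\downarrow 0$, for every bounded cylinder function $f$ (bounded and depending on finitely many coordinates). A probability measure $\nu$ on $\mathbb N^{\mathbb Z^d}$ is called invariant if $\nu(\Omega)=1$ and $\int S(t)f\,d\nu=\int f\,d\nu$ for all $t\ge 0$ and all bounded measurable $f:\Omega\to\mathbb R$ that are Lipschitz for $\|\eta-\zeta\|$. Let $\mu$ be a probability measure on $\mathbb N$, with finite or infinite first moment, and let $\bar\mu=\mu^{\otimes\mathbb Z^d}$ be the translation invariant product measure with single site marginal $\mu$. Assume that $\bar\mu$ is invariant if and only if $\int\mathcal L f\,d\bar\mu=0$ for every bounded cylinder function $f$ on $\mathbb N^{\mathbb Z^d}$. For $\alpha,\beta\ge0$ set $$\mathbf A(\alpha,\beta)=\sum_{k\le\beta}g^k_{\alpha+k,\beta-k}\frac{\mu(\alpha+k)\mu(\beta-k)}{\mu(\alpha)\mu(\beta)}-\sum_{k\le\alpha}g^k_{\alpha,\beta}\quad\text{if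 }\mu(\alpha)\mu(\beta)\ne0,$$ and $\mathbf A(\alpha,\beta)=0$ otherwise. Consider the conditions 1. $\sum_{k\le\beta}g^k_{\alpha+k,\beta-k}\,\mu(\alpha+k)\mu(\beta-k)=0$ for all $\alpha,\beta$ with $\mu(\alpha)\mu(\beta)=0$; 2. $\mathbf A(\alpha,\beta)=-\mathbf A(\beta,\alpha)$ for all $\alpha,\beta$; 3. there is $\psi:\mathbb N\to\mathbb R$ with $\mathbf A(\alpha,\beta)=\psi(\beta)-\psi(\alpha)$ for all $\alpha,\beta$ with $\mu(\alpha)\mu(\beta)\ne0$. Then: * if $\bar\mu$ is invariant, then (1) and (2) hold; * if $p$ is symmetric ($p(x,y)=p(y,x)$ for all $x,y$), then $\bar\mu$ is invariant if and only if (1) and (2) hold; * if $p$ is not symmetric, then $\bar\mu$ is invariant if and only if (1) and (3) hold. -/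

import Mathlib

open MeasureTheory ProbabilityTheory Filter Topology
open scoped NNReal ENNReal

noncomputable section

/-- The sites: the lattice `ℤ^d`. -/
abbrev Site (d : ℕ) : Type := Fin d → ℤ

/-- The configurations: `η x` is the number of particles at the site `x`. The configuration space
carries the product `σ`-algebra. -/
abbrev Config (d : ℕ) : Type := Site d → ℕ

/-- `p` is a translation invariant, irreducible transition probability on `ℤ^d`. -/
structure IsTransition {d : ℕ} (p : Site d → Site d → ℝ) : Prop where
  nonneg : ∀ x y, 0 ≤ p x y
  hasSum_one : ∀ x, HasSum (p x) 1
  translation : ∀ x y z, p (x + z) (y + z) = p x y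
  irreducible : ∀ x y, Relation.ReflTransGen (fun u v => 0 < p u v) x y

/-- `p` is symmetric; "asymmetric" is the negation. -/
def IsSymmetricTransition {d : ℕ} (p : Site d → Site d → ℝ) : Prop :=
  ∀ x y, p x y = p y x

/-- The positive summable weights `a` that define the norm `‖η‖ = ∑ x, η x * a x`. All series here
have nonnegative terms and converge, because `p ≤ 1` and `a` is summable. -/
structure IsWeight {d : ℕ} (p : Site d → Site d → ℝ) (a : Site d → ℝ) : Prop where
  pos : ∀ x, 0 < a x
  summable : Summable a
  bound : ∃ M : ℝ, ∀ x, ∑' y, p x y * a y + ∑' y, a y * p y x ≤ M * a x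

/-- The migration rates: `g α β k` is the rate `g^k_{α,β}` at which `k` particles leave a site
occupied by `α` particles for a site occupied by `β` particles. -/
structure IsRate (g : ℕ → ℕ → ℕ → ℝ) : Prop where
  zero : ∀ α β, g α β 0 = 0
  nonneg : ∀ α β k, 0 < k → k ≤ α → 0 ≤ g α β k
  eq_zero : ∀ α β k, α < k ∨ α = 0 → g α β k = 0

/-- The total rates `∑_{k ≤ α} g^k_{α,β}` are bounded by one constant. -/
def BoundedTotalRates (g : ℕ → ℕ → ℕ → ℝ) : Prop :=
  ∃ C : ℝ, ∀ α β, ∑ k ∈ Finset.range (α + 1), g α β k ≤ C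

/-- The configuration obtained from `η` when `k` particles move from `x` to `y`, and `η` itself when
fewer than `k` particles are present at `x` (or when `x = y`). -/
def migrate {d : ℕ} (η : Config d) (x y : Site d) (k : ℕ) : Config d := fun z =>
  if k ≤ η x then (η z - (if z = x then k else 0)) + (if z = y then k else 0) else η z

/-- The generator
`𝓛 f η = ∑_{x,y} ∑_{k > 0} p(x,y) g^k_{η(x),η(y)} (f (S^k_{x,y} η) - f η)`;
the terms with `k > η x` vanish. -/
def generator {d : ℕ} (p : Site d → Site d → ℝ) (g : ℕ → ℕ → ℕ → ℝ)
    (f : Config d → ℝ) (η : Config d) : ℝ :=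
  ∑' e : Site d × Site d, ∑ k ∈ Finset.Icc 1 (η e.1),
    p e.1 e.2 * g (η e.1) (η e.2) k * (f (migrate η e.1 e.2 k) - f η)

/-- `f` is a bounded cylinder function: it is bounded and depends on finitely many sites. -/
def IsBoundedCylinder {d : ℕ} (f : Config d → ℝ) : Prop :=
  (∃ m : ℝ, ∀ η, |f η| ≤ m) ∧ ∃ V : Finset (Site d), DependsOn f (V : Set (Site d))

/-- The distance `‖η - ζ‖ = ∑ x, |η x - ζ x| * a x`, possibly infinite. -/
def weightedDist {d : ℕ} (a : Site d → ℝ) (η ζ : Config d) : ℝ≥0∞ :=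
  ∑' x, ENNReal.ofReal (|(η x : ℝ) - (ζ x : ℝ)| * a x)

/-- Lipschitz functions on a set `Ω` of configurations, for the distance `‖η - ζ‖`. -/
def IsLipschitz {d : ℕ} (a : Site d → ℝ) {Ω : Set (Config d)} (f : Ω → ℝ) : Prop :=
  ∃ K : ℝ, 0 < K ∧ ∀ η ζ : Ω,
    ENNReal.ofReal |f η - f ζ| ≤ ENNReal.ofReal K * weightedDist a (η : Config d) (ζ : Config d)

/-- A Markov semigroup with generator `𝓛`, on a measurable state space of configurations, given by
its transition kernels. That its generator is `𝓛` means that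
`(S(t) f - f) / t → 𝓛 f` pointwise as `t → 0+`, for every bounded cylinder function `f`. -/
structure MigrationSemigroup {d : ℕ} (p : Site d → Site d → ℝ) (g : ℕ → ℕ → ℕ → ℝ) where
  state : Set (Config d)
  measurableSet_state : MeasurableSet state
  kernel : ℝ≥0 → Kernel state state
  isMarkovKernel : ∀ t, IsMarkovKernel (kernel t)
  kernel_zero : kernel 0 = Kernel.id
  kernel_add : ∀ s t, kernel (s + t) = (kernel t).comp (kernel s)
  tendsto_generator : ∀ f : Config d → ℝ, IsBoundedCylinder f → ∀ η : state,
    Tendsto (fun t : ℝ≥0 => ((∫ ζ, f (ζ : Config d) ∂(kernel t η)) - f (η : Config d)) / (t : ℝ))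
      (𝓝[>] 0) (𝓝 (generator p g f (η : Config d)))

/-- The action of the semigroup on functions: `S(t) f η = ∫ f(ζ) P_t(η, dζ)`. -/
def MigrationSemigroup.op {d : ℕ} {p : Site d → Site d → ℝ} {g : ℕ → ℕ → ℕ → ℝ}
    (S : MigrationSemigroup p g) (t : ℝ≥0) (f : S.state → ℝ) (η : S.state) : ℝ :=
  ∫ ζ, f ζ ∂(S.kernel t η)

/-- The measure `ν` is invariant: it is carried by the state space, and `∫ S(t) f dν = ∫ f dν` for
all bounded Lipschitz `f` on the state space and all `t ≥ 0`. Measurability of `f` is automatic if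
all configurations of the state space have finite norm. -/
def MigrationSemigroup.IsInvariant {d : ℕ} {p : Site d → Site d → ℝ} {g : ℕ → ℕ → ℕ → ℝ}
    (S : MigrationSemigroup p g) (a : Site d → ℝ) (ν : Measure (Config d)) : Prop :=
  ν S.stateᶜ = 0 ∧
  ∀ f : S.state → ℝ, Measurable f → (∃ m : ℝ, ∀ η, |f η| ≤ m) → IsLipschitz a f → ∀ t : ℝ≥0,
    ∫ η, S.op t f η ∂(ν.comap Subtype.val) = ∫ η, f η ∂(ν.comap Subtype.val)

/-- `∫ 𝓛 f dν = 0` for every bounded cylinder function `f`. -/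
def GeneratorIntegralZero {d : ℕ} (p : Site d → Site d → ℝ) (g : ℕ → ℕ → ℕ → ℝ)
    (ν : Measure (Config d)) : Prop :=
  ∀ f : Config d → ℝ, IsBoundedCylinder f → ∫ η, generator p g f η ∂ν = 0

/-- The quantity `A(α,β)` attached to the rates `g` and the single site marginal `μ`. -/
def balanceA (g : ℕ → ℕ → ℕ → ℝ) (μ : Measure ℕ) (α β : ℕ) : ℝ :=
  if μ.real {α} * μ.real {β} ≠ 0 then
    (∑ k ∈ Finset.range (β + 1),
      g (α + k) (β - k) k * (μ.real {α + k} * μ.real {β - k} / (μ.real {α} * μ.real {β})))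
      - ∑ k ∈ Finset.range (α + 1), g α β k
  else 0

/-- No rate leads from pairs of occupation numbers charged by `μ ⊗ μ` to pairs that are not. -/
def NoExitCondition (g : ℕ → ℕ → ℕ → ℝ) (μ : Measure ℕ) : Prop :=
  ∀ α β : ℕ, μ.real {α} * μ.real {β} = 0 →
    ∑ k ∈ Finset.range (β + 1), g (α + k) (β - k) k * μ.real {α + k} * μ.real {β - k} = 0

/-- `A(α,β) = -A(β,α)` for all `α, β`. -/
def AntisymmetryCondition (g : ℕ → ℕ → ℕ → ℝ) (μ : Measure ℕ) : Prop :=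
  ∀ α β : ℕ, balanceA g μ α β = -balanceA g μ β α

/-- `A(α,β) = ψ(β) - ψ(α)` for some `ψ` and all `α, β` charged by `μ`. -/
def PotentialCondition (g : ℕ → ℕ → ℕ → ℝ) (μ : Measure ℕ) : Prop :=
  ∃ ψ : ℕ → ℝ, ∀ α β : ℕ, μ.real {α} * μ.real {β} ≠ 0 → balanceA g μ α β = ψ β - ψ α

end

/-! By the assumed equivalence, invariance means that the generator integrates to zero. Everything
reduces to one array Φ = `massFlow`, the net gain of the pair (α, β) when independent
`μ`-distributed occupation numbers undergo jumps from the first to the second site. The integral of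
the generator at `f` is the sum over x, y of p(x,y) times the pairing of Φ with the conditional mean
of `f` given η(x), η(y) (`hasSum_integral_jumpTerm`, `hasSum_integral_generator`). Conditions (1)
and (2) together say that Φ is antisymmetric; (1) and (3) say that Φ(α,β) = μ(α)μ(β)(ψ(β) - ψ(α)).

Necessity: one-site test functions show that the two marginals of Φ are u and -u. Products of
centered indicators at two sites see only the edges (x,y) and (y,x), so the doubly centered part D
of Φ satisfies p(x,y)D(α,β) + p(y,x)D(β,α) = 0. Hence D is antisymmetric, and so is Φ = D + μ(β)u(α)
- μ(α)u(β). If p(x,y) ≠ p(y,x) for some pair, then D = 0 and ψ = -u/μ is a potential.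

Sufficiency: for symmetric p and antisymmetric Φ, exchanging x and y changes the sign of the whole
sum. For potential Φ, the edge (x,y) contributes p(x,y)(h(y) - h(x)) with h finitely supported, and
this sums to zero because the rows and the columns of p all sum to 1. -/

/-! ### Conditioning the product measure on two sites. -/

section ProductMeasure

variable {d : ℕ} (μ : Measure ℕ) [IsProbabilityMeasure μ]

/-- The translation invariant product measure with single site marginal `μ`. -/
noncomputable abbrev productMeasure (d : ℕ) (μ : Measure ℕ) : Measure (Config d) :=
  Measure.infinitePi fun _ : Site d => μ

theorem DependsOn.measurable_config {f : Config d → ℝ} {V : Finset (Site d)}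
    (hf : DependsOn f (V : Set (Site d))) : Measurable f := by
  obtain ⟨h, rfl⟩ := dependsOn_iff_exists_comp.1 hf
  have : Countable (↥(V : Set (Site d)) → ℕ) := inferInstanceAs (Countable (V → ℕ))
  exact (Measurable.of_discrete).comp (by fun_prop)

theorem IsBoundedCylinder.measurable {f : Config d → ℝ} (hf : IsBoundedCylinder f) :
    Measurable f :=
  let ⟨_, _, hV⟩ := hf
  hV.measurable_config

/-- Replacing one coordinate by an independent copy does not change the law: on boxes, the factor of
the site `x` splits off. -/
theorem measurePreserving_update (x : Site d) :
    MeasurePreserving (fun q : ℕ × Config d => Function.update q.2 x q.1)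
      (μ.prod (productMeasure d μ)) (productMeasure d μ) := by
  have hm : Measurable (fun q : ℕ × Config d => Function.update q.2 x q.1) :=
    measurable_update'.comp measurable_swap
  refine ⟨hm, Measure.eq_infinitePi _ fun s t ht => ?_⟩
  rw [Measure.map_apply hm (.pi s.countable_toSet fun _ _ => ht _)]
  by_cases hx : x ∈ s
  · have : (fun q : ℕ × Config d => Function.update q.2 x q.1) ⁻¹' ((s : Set (Site d)).pi t) =
        t x ×ˢ (((s.erase x : Finset (Site d)) : Set (Site d)).pi t) := by
      ext ⟨n, η⟩
      simp only [Set.mem_preimage, Set.mem_pi, Set.mem_prod, Finset.mem_coe, Finset.mem_erase]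
      constructor
      · intro h
        refine ⟨by simpa using h x hx, fun i hi => ?_⟩
        simpa [hi.1] using h i hi.2
      · rintro ⟨h1, h2⟩ i hi
        by_cases h : i = x
        · subst h; simpa using h1
        · simpa [h] using h2 i ⟨h, hi⟩
    rw [this, Measure.prod_prod, Measure.infinitePi_pi _ fun i _ => ht i,
      Finset.mul_prod_erase s (fun i => μ (t i)) hx]
  · have : (fun q : ℕ × Config d => Function.update q.2 x q.1) ⁻¹' ((s : Set (Site d)).pi t) =
        Set.univ ×ˢ ((s : Set (Site d)).pi t) := by
      ext ⟨n, η⟩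
      simp only [Set.mem_preimage, Set.mem_pi, Set.mem_prod, Finset.mem_coe, Set.mem_univ,
        true_and]
      refine forall₂_congr fun i hi => ?_
      rw [Function.update_of_ne (ne_of_mem_of_not_mem hi hx)]
    rw [this, Measure.prod_prod, Measure.infinitePi_pi _ fun i _ => ht i, measure_univ, one_mul]

theorem measurePreserving_update_update (x y : Site d) :
    MeasurePreserving
      (fun q : (ℕ × ℕ) × Config d => Function.update (Function.update q.2 x q.1.1) y q.1.2)
      ((μ.prod μ).prod (productMeasure d μ)) (productMeasure d μ) := by
  have h1 : MeasurePreserving (fun q : (ℕ × ℕ) × Config d => (q.1.2, (q.1.1, q.2)))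
      ((μ.prod μ).prod (productMeasure d μ)) (μ.prod (μ.prod (productMeasure d μ))) :=
    (measurePreserving_prodAssoc μ μ (productMeasure d μ)).comp
      ((Measure.measurePreserving_swap (μ := μ) (ν := μ)).prod
        (MeasurePreserving.id (productMeasure d μ)))
  exact (measurePreserving_update μ y).comp
    (((MeasurePreserving.id μ).prod (measurePreserving_update μ x)).comp h1)

/-- The mean of `f` under the product measure, given the occupation numbers of two sites. -/
noncomputable def pairMean (f : Config d → ℝ) (x y : Site d) (α β : ℕ) : ℝ :=
  ∫ η, f (Function.update (Function.update η x α) y β) ∂(productMeasure d μ)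

/-- Resample both sites, apply Fubini, and write `μ.prod μ` as a sum of point masses. -/
theorem hasSum_pairMean {f : Config d → ℝ} (hf : Integrable f (productMeasure d μ))
    (x y : Site d) :
    HasSum (fun q : ℕ × ℕ => μ.real {q.1} * μ.real {q.2} * pairMean μ f x y q.1 q.2)
      (∫ η, f η ∂(productMeasure d μ)) := by
  have hφ := measurePreserving_update_update μ x y
  have hi := (hφ.integrable_comp hf.aestronglyMeasurable).2 hf
  have h1 : ∫ η, f η ∂(productMeasure d μ) =
      ∫ q : ℕ × ℕ, pairMean μ f x y q.1 q.2 ∂(μ.prod μ) := by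
    rw [← hφ.map_eq] at hf ⊢
    rw [integral_map hφ.measurable.aemeasurable hf.aestronglyMeasurable]
    exact integral_prod _ hi
  have h2 : Integrable (fun q : ℕ × ℕ => pairMean μ f x y q.1 q.2) (μ.prod μ) :=
    hi.integral_prod_left
  rw [h1]
  rw [← Measure.sum_smul_dirac (μ.prod μ)] at h2 ⊢
  refine (hasSum_integral_measure h2).congr_fun ?_
  rintro ⟨a, b⟩
  rw [integral_smul_measure, integral_dirac, ← Set.singleton_prod_singleton, Measure.prod_prod,
    ENNReal.toReal_mul, smul_eq_mul]
  rfl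

theorem pairMean_swap (μ : Measure ℕ) (f : Config d → ℝ) {x y : Site d} (hxy : x ≠ y) (α β : ℕ) :
    pairMean μ f y x β α = pairMean μ f x y α β := by
  simp only [pairMean, Function.update_comm hxy]

theorem abs_pairMean_le {f : Config d → ℝ} {m : ℝ} (hf : ∀ η, |f η| ≤ m) (x y : Site d)
    (α β : ℕ) : |pairMean μ f x y α β| ≤ m := by
  simpa [pairMean] using norm_integral_le_of_norm_le_const (μ := productMeasure d μ)
    (f := fun η => f (Function.update (Function.update η x α) y β))
    (ae_of_all _ fun η => hf _)

theorem integrable_of_bounded {f : Config d → ℝ} (hm : Measurable f) {m : ℝ}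
    (hf : ∀ η, |f η| ≤ m) : Integrable f (productMeasure d μ) :=
  Integrable.of_bound hm.aestronglyMeasurable m (ae_of_all _ hf)

theorem integral_eval (φ : ℕ → ℝ) (x : Site d) :
    ∫ η, φ (η x) ∂(productMeasure d μ) = ∫ n, φ n ∂μ := by
  have h := measurePreserving_eval_infinitePi (fun _ : Site d => μ) x
  rw [← h.map_eq, integral_map h.measurable.aemeasurable
    Measurable.of_discrete.aestronglyMeasurable, h.map_eq]

theorem summable_real_mul_real :
    Summable fun q : ℕ × ℕ => μ.real {q.1} * μ.real {q.2} := by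
  have := hasSum_pairMean (d := 0) μ (f := fun _ => 1) (integrable_const _) 0 0
  simpa [pairMean] using this.summable

end ProductMeasure

/-! ### The flow of mass between two sites. -/

section Rates

variable {g : ℕ → ℕ → ℕ → ℝ}

theorem IsRate.nonneg_all (hg : IsRate g) (α β k : ℕ) : 0 ≤ g α β k := by
  rcases Nat.eq_zero_or_pos k with rfl | hk
  · rw [hg.zero]
  · rcases le_or_gt k α with h | h
    · exact hg.nonneg _ _ _ hk h
    · rw [hg.eq_zero _ _ _ (Or.inl h)]

theorem IsRate.sum_Icc (hg : IsRate g) (α β : ℕ) (h : ℕ → ℝ) :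
    ∑ k ∈ Finset.Icc 1 α, g α β k * h k = ∑ k ∈ Finset.range (α + 1), g α β k * h k := by
  refine Finset.sum_subset (fun k hk => ?_) fun k hk hk' => ?_
  · simp only [Finset.mem_Icc, Finset.mem_range] at *; omega
  · have : k = 0 := by simp only [Finset.mem_Icc, Finset.mem_range] at *; omega
    rw [this, hg.zero, zero_mul]

theorem IsRate.bound_nonneg (hg : IsRate g) {C : ℝ}
    (hC : ∀ α β, ∑ k ∈ Finset.range (α + 1), g α β k ≤ C) : 0 ≤ C := by
  simpa [hg.zero] using hC 0 0

/-- The change of the mass of the pair `(α, β)` per unit of time, when the occupation numbers of the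
two sites are independent with law `μ` and particles migrate from the first to the second site. -/
noncomputable def massFlow (g : ℕ → ℕ → ℕ → ℝ) (μ : Measure ℕ) (α β : ℕ) : ℝ :=
  (∑ k ∈ Finset.range (β + 1), g (α + k) (β - k) k * μ.real {α + k} * μ.real {β - k}) -
    μ.real {α} * μ.real {β} * ∑ k ∈ Finset.range (α + 1), g α β k

theorem hasSum_sum_range_shift {H : ℕ → ℕ → ℕ → ℝ} (h0 : ∀ α β k, α < k → H α β k = 0) {s : ℝ}
    (hs : HasSum (fun t : (ℕ × ℕ) × ℕ => H t.1.1 t.1.2 t.2) s) :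
    HasSum (fun q : ℕ × ℕ => ∑ k ∈ Finset.range (q.2 + 1), H (q.1 + k) (q.2 - k) k) s := by
  -- A jump is coded by what stays at the source, what the target held, and the number moved; `i`
  -- gives the occupation numbers before the jump, `j` those after it. Outside the ranges of `i` and
  -- `j` the summands vanish.
  let i : (ℕ × ℕ) × ℕ → (ℕ × ℕ) × ℕ := fun t => ((t.1.1 + t.2, t.1.2), t.2)
  let j : (ℕ × ℕ) × ℕ → (ℕ × ℕ) × ℕ := fun t => ((t.1.1, t.1.2 + t.2), t.2)
  have hi : Function.Injective i := by
    rintro ⟨⟨a, b⟩, c⟩ ⟨⟨a', b'⟩, c'⟩ h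
    simp only [i, Prod.mk.injEq] at h ⊢
    omega
  have hj : Function.Injective j := by
    rintro ⟨⟨a, b⟩, c⟩ ⟨⟨a', b'⟩, c'⟩ h
    simp only [j, Prod.mk.injEq] at h ⊢
    omega
  let H' : (ℕ × ℕ) × ℕ → ℝ := fun t =>
    if t.2 ≤ t.1.2 then H (t.1.1 + t.2) (t.1.2 - t.2) t.2 else 0
  have h1 : HasSum ((fun t : (ℕ × ℕ) × ℕ => H t.1.1 t.1.2 t.2) ∘ i) s := by
    refine (hi.hasSum_iff ?_).2 hs
    rintro ⟨⟨a, b⟩, c⟩ h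
    refine h0 _ _ _ (lt_of_not_ge fun hca => h ⟨((a - c, b), c), ?_⟩)
    simp only [i, Prod.mk.injEq, and_true] at hca ⊢
    omega
  have h2 : H' ∘ j = (fun t : (ℕ × ℕ) × ℕ => H t.1.1 t.1.2 t.2) ∘ i := by
    ext ⟨⟨a, b⟩, c⟩
    simp [H', i, j]
  rw [← h2, hj.hasSum_iff] at h1
  · refine h1.prod_fiberwise fun q => ?_
    have : ∑ k ∈ Finset.range (q.2 + 1), H (q.1 + k) (q.2 - k) k =
        ∑ k ∈ Finset.range (q.2 + 1), H' (q, k) :=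
      Finset.sum_congr rfl fun k hk => by
        simp only [H']
        rw [if_pos (by simpa [Nat.lt_succ_iff] using hk)]
    rw [this]
    refine hasSum_sum_of_ne_finset_zero fun k hk => ?_
    simp only [H']
    rw [if_neg (by simpa [Nat.lt_succ_iff] using hk)]
  · rintro ⟨⟨a, b⟩, c⟩ h
    simp only [H']
    refine if_neg fun hcb => h ⟨((a, b - c), c), ?_⟩
    simp only [j, Prod.mk.injEq, and_true, true_and]
    omega

/-- Change of variables: the mean rate of change of `F` is its pairing with the flow of mass. -/
theorem hasSum_massFlow_mul (hg : IsRate g) (hgC : BoundedTotalRates g) (μ : Measure ℕ)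
    [IsProbabilityMeasure μ] {F : ℕ → ℕ → ℝ} {m : ℝ} (hF : ∀ α β, |F α β| ≤ m) {s : ℝ}
    (hs : HasSum (fun q : ℕ × ℕ => μ.real {q.1} * μ.real {q.2} *
      ∑ k ∈ Finset.range (q.1 + 1), g q.1 q.2 k * (F (q.1 - k) (q.2 + k) - F q.1 q.2)) s) :
    HasSum (fun q : ℕ × ℕ => massFlow g μ q.1 q.2 * F q.1 q.2) s := by
  obtain ⟨C, hC⟩ := hgC
  have hμ := summable_real_mul_real μ
  have hr : ∀ q : ℕ × ℕ, 0 ≤ ∑ k ∈ Finset.range (q.1 + 1), g q.1 q.2 k := fun q =>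
    Finset.sum_nonneg fun _ _ => hg.nonneg_all _ _ _
  have hμ0 : ∀ q : ℕ × ℕ, 0 ≤ μ.real {q.1} * μ.real {q.2} := fun q => by positivity
  have hloss : Summable fun q : ℕ × ℕ =>
      μ.real {q.1} * μ.real {q.2} * (∑ k ∈ Finset.range (q.1 + 1), g q.1 q.2 k) * F q.1 q.2 := by
    refine Summable.of_norm_bounded ((hμ.mul_right C).mul_right m) fun q => ?_
    rw [Real.norm_eq_abs, abs_mul, abs_of_nonneg (mul_nonneg (hμ0 q) (hr q))]
    have := hC q.1 q.2
    have h0 := hμ0 q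
    have hm := hF q.1 q.2
    have hCn : 0 ≤ C := hg.bound_nonneg hC
    gcongr
  have hfiber : ∀ (q : ℕ × ℕ) (h : ℕ → ℝ), HasSum
      (fun k => μ.real {q.1} * μ.real {q.2} * (g q.1 q.2 k * h k))
      (μ.real {q.1} * μ.real {q.2} * ∑ k ∈ Finset.range (q.1 + 1), g q.1 q.2 k * h k) := by
    intro q h
    rw [Finset.mul_sum]
    refine hasSum_sum_of_ne_finset_zero fun k hk => ?_
    rw [hg.eq_zero _ _ _ (Or.inl (by simpa [Nat.lt_succ_iff] using hk)), zero_mul, mul_zero]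
  -- The bound on the total rates gives absolute convergence over all triples (α, β, k), which
  -- allows gain and loss to be separated and the gain to be reindexed.
  have htriple : Summable fun t : (ℕ × ℕ) × ℕ =>
      μ.real {t.1.1} * μ.real {t.1.2} * (g t.1.1 t.1.2 t.2 * 1) := by
    refine (summable_prod_of_nonneg fun t => ?_).2 ⟨fun q => (hfiber q fun _ => 1).summable, ?_⟩
    · have := hg.nonneg_all t.1.1 t.1.2 t.2
      have := hμ0 t.1
      simp only [Pi.zero_apply]
      positivity
    · refine Summable.of_nonneg_of_le (fun q => ?_) (fun q => ?_) (hμ.mul_right C)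
      · exact tsum_nonneg fun k => mul_nonneg (hμ0 q) (by simpa using hg.nonneg_all _ _ _)
      · rw [(hfiber q fun _ => 1).tsum_eq]
        have := hC q.1 q.2
        have h0 := hμ0 q
        simp only [mul_one]
        gcongr
  have hgain3 : Summable fun t : (ℕ × ℕ) × ℕ => μ.real {t.1.1} * μ.real {t.1.2} *
      (g t.1.1 t.1.2 t.2 * F (t.1.1 - t.2) (t.1.2 + t.2)) := by
    refine Summable.of_norm_bounded (htriple.mul_right m) fun t => ?_
    have h1 := hg.nonneg_all t.1.1 t.1.2 t.2
    have h0 := hμ0 t.1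
    have hm := hF (t.1.1 - t.2) (t.1.2 + t.2)
    rw [Real.norm_eq_abs, ← mul_assoc, abs_mul, abs_of_nonneg (mul_nonneg h0 h1), mul_one]
    gcongr
  have hgain := hgain3.hasSum.prod_fiberwise fun q => hfiber q fun k => F (q.1 - k) (q.2 + k)
  have hshift := hasSum_sum_range_shift
    (H := fun α β k => μ.real {α} * μ.real {β} * (g α β k * F (α - k) (β + k)))
    (fun α β k h => by simp [hg.eq_zero α β k (Or.inl h)]) hgain3.hasSum
  have hsum := (hgain.sub hloss.hasSum).unique (hs.congr_fun fun q => by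
    simp only [mul_sub, Finset.sum_sub_distrib, ← Finset.sum_mul]
    ring)
  rw [← hsum]
  refine (hshift.sub hloss.hasSum).congr_fun fun q => ?_
  rw [massFlow, sub_mul, Finset.sum_mul]
  congr 1
  refine Finset.sum_congr rfl fun k hk => ?_
  have hk : k ≤ q.2 := by simpa [Nat.lt_succ_iff] using hk
  rw [Nat.add_sub_cancel, Nat.sub_add_cancel hk]
  ring

end Rates

/-! ### Integrating the generator edge by edge. -/

section Migration

variable {d : ℕ} {p : Site d → Site d → ℝ} {g : ℕ → ℕ → ℕ → ℝ}

/-- The part of the generator that describes the jumps from `x` to `y`, at rate one. -/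
noncomputable def jumpTerm (g : ℕ → ℕ → ℕ → ℝ) (f : Config d → ℝ) (x y : Site d)
    (η : Config d) : ℝ :=
  ∑ k ∈ Finset.Icc 1 (η x), g (η x) (η y) k * (f (migrate η x y k) - f η)

theorem generator_eq_tsum (f : Config d → ℝ) (η : Config d) :
    generator p g f η = ∑' e : Site d × Site d, p e.1 e.2 * jumpTerm g f e.1 e.2 η := by
  simp only [generator, jumpTerm, Finset.mul_sum, mul_assoc]

theorem migrate_apply_of_ne (η : Config d) {x y z : Site d} (hx : z ≠ x) (hy : z ≠ y) (k : ℕ) :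
    migrate η x y k z = η z := by
  simp [migrate, hx, hy]

theorem migrate_self (η : Config d) (x : Site d) (k : ℕ) : migrate η x x k = η := by
  ext z
  by_cases h : z = x
  · subst h
    simp only [migrate, if_true, ite_eq_right_iff]
    omega
  · exact migrate_apply_of_ne η h h k

theorem migrate_update_update (η : Config d) {x y : Site d} (hxy : x ≠ y) {α k : ℕ} (β : ℕ)
    (hk : k ≤ α) :
    migrate (Function.update (Function.update η x α) y β) x y k =
      Function.update (Function.update η x (α - k)) y (β + k) := by
  ext z
  by_cases hy : z = y
  · subst hy
    simp [migrate, hxy, hxy.symm, hk]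
  · by_cases hx : z = x
    · subst hx
      simp [migrate, hxy, hk]
    · simp [migrate, hx, hy]

theorem jumpTerm_self (f : Config d → ℝ) (x : Site d) (η : Config d) : jumpTerm g f x x η = 0 := by
  simp [jumpTerm, migrate_self]

theorem jumpTerm_eq_zero {f : Config d → ℝ} {V : Finset (Site d)}
    (hf : DependsOn f (V : Set (Site d))) {x y : Site d} (hx : x ∉ V) (hy : y ∉ V)
    (η : Config d) : jumpTerm g f x y η = 0 := by
  refine Finset.sum_eq_zero fun k _ => ?_
  rw [hf (x := migrate η x y k) (y := η) fun z hz => ?_, sub_self, mul_zero]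
  exact migrate_apply_of_ne η (ne_of_mem_of_not_mem hz hx) (ne_of_mem_of_not_mem hz hy) k

theorem dependsOn_jumpTerm {f : Config d → ℝ} {V : Finset (Site d)}
    (hf : DependsOn f (V : Set (Site d))) (x y : Site d) :
    DependsOn (jumpTerm g f x y) ((insert x (insert y V) : Finset (Site d)) : Set (Site d)) := by
  intro η ζ h
  have hx : η x = ζ x := h x (by simp)
  have hy : η y = ζ y := h y (by simp)
  have hV : ∀ z ∈ (V : Set (Site d)), η z = ζ z := fun z hz => h z (by simp_all)
  rw [jumpTerm, jumpTerm, hx, hy]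
  refine Finset.sum_congr rfl fun k _ => ?_
  rw [hf hV, hf (x := migrate η x y k) (y := migrate ζ x y k) fun z hz => ?_]
  simp only [migrate, hx, hV z hz]

theorem abs_jumpTerm_le (hg : IsRate g) {C : ℝ}
    (hC : ∀ α β, ∑ k ∈ Finset.range (α + 1), g α β k ≤ C) {f : Config d → ℝ} {m : ℝ}
    (hf : ∀ η, |f η| ≤ m) (x y : Site d) (η : Config d) :
    |jumpTerm g f x y η| ≤ C * (2 * m) := by
  have hm : 0 ≤ m := (abs_nonneg _).trans (hf η)
  rw [jumpTerm, hg.sum_Icc]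
  calc _ ≤ ∑ k ∈ Finset.range (η x + 1), g (η x) (η y) k * (2 * m) := by
        refine (Finset.abs_sum_le_sum_abs _ _).trans (Finset.sum_le_sum fun k _ => ?_)
        rw [abs_mul, abs_of_nonneg (hg.nonneg_all _ _ _)]
        refine mul_le_mul_of_nonneg_left ?_ (hg.nonneg_all _ _ _)
        have h1 := hf (migrate η x y k)
        have h2 := hf η
        rw [abs_le] at *
        constructor <;> linarith
    _ ≤ _ := by
        rw [← Finset.sum_mul]
        exact mul_le_mul_of_nonneg_right (hC _ _) (by positivity)

theorem integrable_jumpTerm (hg : IsRate g) (hgC : BoundedTotalRates g) (μ : Measure ℕ)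
    [IsProbabilityMeasure μ] {f : Config d → ℝ} (hf : IsBoundedCylinder f) (x y : Site d) :
    Integrable (jumpTerm g f x y) (productMeasure d μ) := by
  obtain ⟨⟨m, hm⟩, V, hV⟩ := hf
  obtain ⟨C, hC⟩ := hgC
  exact integrable_of_bounded μ (dependsOn_jumpTerm hV x y).measurable_config
    (abs_jumpTerm_le hg hC hm x y)

/-- Given the occupation numbers of `x` and `y`, the mean of the jump term is the two-site jump
operator applied to `pairMean`, so the change of variables applies. The array paired with `f`
depends neither on `f` nor on the edge. -/
theorem hasSum_integral_jumpTerm (hg : IsRate g) (hgC : BoundedTotalRates g) (μ : Measure ℕ)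
    [IsProbabilityMeasure μ] {f : Config d → ℝ} (hf : IsBoundedCylinder f) {x y : Site d}
    (hxy : x ≠ y) :
    HasSum (fun q : ℕ × ℕ => massFlow g μ q.1 q.2 * pairMean μ f x y q.1 q.2)
      (∫ η, jumpTerm g f x y η ∂(productMeasure d μ)) := by
  obtain ⟨m, hm⟩ := hf.1
  refine hasSum_massFlow_mul hg hgC μ (abs_pairMean_le μ hm x y)
    ((hasSum_pairMean μ (integrable_jumpTerm hg hgC μ hf x y) x y).congr_fun ?_)
  rintro ⟨α, β⟩
  have hi : ∀ α β, Integrable (fun η => f (Function.update (Function.update η x α) y β))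
      (productMeasure d μ) := fun α β => integrable_of_bounded μ
    (hf.measurable.comp (measurable_update_left.comp measurable_update_left)) fun η => hm _
  have : ∀ η, jumpTerm g f x y (Function.update (Function.update η x α) y β) =
      ∑ k ∈ Finset.range (α + 1), g α β k *
        (f (Function.update (Function.update η x (α - k)) y (β + k)) -
          f (Function.update (Function.update η x α) y β)) := by
    intro η
    rw [jumpTerm, hg.sum_Icc]
    simp only [Function.update_self, Function.update_of_ne hxy]
    refine Finset.sum_congr rfl fun k hk => ?_
    rw [migrate_update_update η hxy β (by simpa [Nat.lt_succ_iff] using hk)]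
  congr 1
  conv_rhs => rw [pairMean]
  simp only [this]
  refine Eq.trans ?_
    (integral_finsetSum _ fun k _ => ((hi (α - k) (β + k)).sub (hi α β)).const_mul (g α β k)).symm
  refine Finset.sum_congr rfl fun k _ => ?_
  simp only [Pi.sub_apply]
  rw [integral_const_mul, integral_sub (hi _ _) (hi _ _)]
  rfl

/-- Translation by y - x gives p(x,y) = p(y, 2y - x), so the reflection x ↦ 2y - x turns the column
into a row. -/
theorem IsTransition.hasSum_col (hp : IsTransition p) (y : Site d) : HasSum (fun x => p x y) 1 := by
  have h := (Equiv.subLeft (2 • y)).hasSum_iff.2 (hp.hasSum_one y)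
  refine h.congr_fun fun x => ?_
  have := hp.translation x y (y - x)
  rw [← this]
  simp only [Function.comp_apply, Equiv.subLeft_apply]
  congr 1 <;> abel

theorem hasSum_mul_fst_of_stochastic (h0 : ∀ x y, 0 ≤ p x y) (h1 : ∀ x, HasSum (p x) 1)
    {h : Site d → ℝ} {V : Finset (Site d)} (hV : ∀ x ∉ V, h x = 0) :
    HasSum (fun e : Site d × Site d => p e.1 e.2 * h e.1) (∑ x ∈ V, h x) := by
  have hfib : ∀ (h : Site d → ℝ) x, HasSum (fun y => p x y * h x) (h x) := fun h x => by
    simpa using (h1 x).mul_right (h x)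
  have habs : Summable (fun e : Site d × Site d => p e.1 e.2 * |h e.1|) := by
    refine (summable_prod_of_nonneg fun e => mul_nonneg (h0 _ _) (abs_nonneg _)).2
      ⟨fun x => (hfib (fun x => |h x|) x).summable, ?_⟩
    simp only [fun x => (hfib (fun x => |h x|) x).tsum_eq]
    exact (hasSum_sum_of_ne_finset_zero (s := V) fun x hx => by simp [hV x hx]).summable
  have hs : Summable (fun e : Site d × Site d => p e.1 e.2 * h e.1) :=
    Summable.of_norm_bounded habs fun e => by
      rw [Real.norm_eq_abs, abs_mul, abs_of_nonneg (h0 _ _)]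
  have h2 := hs.hasSum.prod_fiberwise (hfib h)
  rw [← h2.unique (hasSum_sum_of_ne_finset_zero hV)]
  exact hs.hasSum

theorem IsTransition.hasSum_mul_fst (hp : IsTransition p) {h : Site d → ℝ} {V : Finset (Site d)}
    (hV : ∀ x ∉ V, h x = 0) :
    HasSum (fun e : Site d × Site d => p e.1 e.2 * h e.1) (∑ x ∈ V, h x) :=
  hasSum_mul_fst_of_stochastic hp.nonneg hp.hasSum_one hV

theorem IsTransition.hasSum_mul_snd (hp : IsTransition p) {h : Site d → ℝ} {V : Finset (Site d)}
    (hV : ∀ x ∉ V, h x = 0) :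
    HasSum (fun e : Site d × Site d => p e.1 e.2 * h e.2) (∑ x ∈ V, h x) :=
  (Equiv.prodComm (Site d) (Site d)).hasSum_iff.2
    (hasSum_mul_fst_of_stochastic (p := fun x y => p y x) (fun x y => hp.nonneg y x)
      hp.hasSum_col hV)

/-- Otherwise no path could leave 0, whereas irreducibility leads from 0 to the constant vector 1, a
different site since `d ≥ 1`. -/
theorem IsTransition.exists_pos_of_ne (hp : IsTransition p) (hd : 1 ≤ d) :
    ∃ x y, x ≠ y ∧ 0 < p x y := by
  by_contra! hcon
  have hstay : ∀ y, Relation.ReflTransGen (fun u v => 0 < p u v) 0 y → y = 0 := by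
    intro y hy
    induction hy with
    | refl => rfl
    | tail _ hbc ih =>
      by_contra hne
      exact absurd hbc (not_lt.2 (hcon _ _ (by rw [ih]; exact Ne.symm hne)))
  have h := congrFun (hstay 1 (hp.irreducible 0 1)) ⟨0, hd⟩
  simp at h

theorem IsTransition.diag_lt_one (hp : IsTransition p) {x y : Site d} (hxy : x ≠ y)
    (h : 0 < p x y) : p x x < 1 := by
  have := sum_le_hasSum {x, y} (fun z _ => hp.nonneg x z) (hp.hasSum_one x)
  rw [Finset.sum_pair hxy] at this
  linarith

/-- The generator may be integrated term by term. -/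
theorem hasSum_integral_generator (hp : IsTransition p) (hg : IsRate g)
    (hgC : BoundedTotalRates g) (μ : Measure ℕ) [IsProbabilityMeasure μ] {f : Config d → ℝ}
    (hf : IsBoundedCylinder f) :
    HasSum (fun e : Site d × Site d =>
        p e.1 e.2 * ∫ η, jumpTerm g f e.1 e.2 η ∂(productMeasure d μ))
      (∫ η, generator p g f η ∂(productMeasure d μ)) := by
  have hint := integrable_jumpTerm hg hgC μ hf
  obtain ⟨⟨m, hm⟩, V, hV⟩ := hf
  obtain ⟨C, hC⟩ := hgC
  simp only [generator_eq_tsum, ← integral_const_mul]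
  refine hasSum_integral_of_summable_integral_norm (fun e => (hint e.1 e.2).const_mul _) ?_
  -- Only edges that meet `V` contribute, so the jump term of (x,y) is at most χ(x) + χ(y); row and
  -- column sums of `p` make this summable.
  let χ : Site d → ℝ := fun x => if x ∈ V then C * (2 * m) else 0
  have hK : 0 ≤ C * (2 * m) :=
    (abs_nonneg _).trans (abs_jumpTerm_le hg hC hm (0 : Site d) 0 0)
  have hχ : ∀ x, 0 ≤ χ x := fun x => by simp only [χ]; split_ifs <;> simp [hK]
  have hχ0 : ∀ x ∉ V, χ x = 0 := fun x hx => if_neg hx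
  refine Summable.of_nonneg_of_le (fun e => integral_nonneg fun η => norm_nonneg _) (fun e => ?_)
    ((hp.hasSum_mul_fst hχ0).add (hp.hasSum_mul_snd hχ0)).summable
  have hb : ∀ η, ‖p e.1 e.2 * jumpTerm g f e.1 e.2 η‖ ≤
      p e.1 e.2 * χ e.1 + p e.1 e.2 * χ e.2 := by
    intro η
    rw [Real.norm_eq_abs, abs_mul, abs_of_nonneg (hp.nonneg _ _), ← mul_add]
    refine mul_le_mul_of_nonneg_left ?_ (hp.nonneg _ _)
    by_cases h1 : e.1 ∈ V
    · refine (abs_jumpTerm_le hg hC hm _ _ η).trans ?_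
      have : χ e.1 = C * (2 * m) := if_pos h1
      linarith [hχ e.2]
    · by_cases h2 : e.2 ∈ V
      · refine (abs_jumpTerm_le hg hC hm _ _ η).trans ?_
        have : χ e.2 = C * (2 * m) := if_pos h2
        linarith [hχ e.1]
      · rw [jumpTerm_eq_zero hV h1 h2, abs_zero]
        exact add_nonneg (hχ _) (hχ _)
  have := integral_mono (((hint e.1 e.2).const_mul (p e.1 e.2)).norm)
    (integrable_const (p e.1 e.2 * χ e.1 + p e.1 e.2 * χ e.2)) hb
  simpa using this

end Migration

/-! ### The conditions in terms of the flow, and its doubly centered part. -/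

section Balance

variable {g : ℕ → ℕ → ℕ → ℝ}

theorem massFlow_eq_mul_balanceA (μ : Measure ℕ) {α β : ℕ}
    (h : μ.real {α} * μ.real {β} ≠ 0) :
    massFlow g μ α β = μ.real {α} * μ.real {β} * balanceA g μ α β := by
  rw [balanceA, if_pos h, mul_sub, Finset.mul_sum, massFlow]
  congr 1
  refine Finset.sum_congr rfl fun k _ => ?_
  rw [mul_left_comm, mul_div_cancel₀ _ h, mul_assoc]

theorem massFlow_of_mul_eq_zero (μ : Measure ℕ) {α β : ℕ} (h : μ.real {α} * μ.real {β} = 0) :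
    massFlow g μ α β =
      ∑ k ∈ Finset.range (β + 1), g (α + k) (β - k) k * μ.real {α + k} * μ.real {β - k} := by
  rw [massFlow, h, zero_mul, sub_zero]

/-- On charged pairs the flow is `balanceA` times a positive symmetric weight. On the other pairs
there is no loss, so the flow is nonnegative in both orders, and antisymmetry forces it to vanish.
-/
theorem noExit_and_antisymmetry_iff (hg : IsRate g) (μ : Measure ℕ) :
    NoExitCondition g μ ∧ AntisymmetryCondition g μ ↔
      ∀ α β, massFlow g μ α β = -massFlow g μ β α := by
  constructor
  · rintro ⟨h1, h2⟩ α β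
    by_cases h : μ.real {α} * μ.real {β} = 0
    · have h' := h
      rw [mul_comm] at h'
      rw [massFlow_of_mul_eq_zero μ h, massFlow_of_mul_eq_zero μ h', h1 _ _ h, h1 _ _ h', neg_zero]
    · have h' := h
      rw [mul_comm] at h'
      rw [massFlow_eq_mul_balanceA μ h, massFlow_eq_mul_balanceA μ h', h2 α β]
      ring
  · refine fun hanti => ⟨fun α β h => ?_, fun α β => ?_⟩
    · have h' := h
      rw [mul_comm] at h'
      have hnn : ∀ α β, 0 ≤ ∑ k ∈ Finset.range (β + 1),
          g (α + k) (β - k) k * μ.real {α + k} * μ.real {β - k} := fun α β =>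
        Finset.sum_nonneg fun k _ =>
          mul_nonneg (mul_nonneg (hg.nonneg_all _ _ _) (by positivity)) (by positivity)
      have := hanti α β
      rw [massFlow_of_mul_eq_zero μ h, massFlow_of_mul_eq_zero μ h'] at this
      linarith [hnn α β, hnn β α]
    · by_cases h : μ.real {α} * μ.real {β} = 0
      · simp [balanceA, h, mul_comm (μ.real {β})]
      · have h' := h
        rw [mul_comm] at h'
        have := hanti α β
        rw [massFlow_eq_mul_balanceA μ h, massFlow_eq_mul_balanceA μ h'] at this
        refine mul_left_cancel₀ h ?_
        rw [this]
        ring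

theorem massFlow_eq_of_potential {μ : Measure ℕ} (h1 : NoExitCondition g μ) {ψ : ℕ → ℝ}
    (hψ : ∀ α β, μ.real {α} * μ.real {β} ≠ 0 → balanceA g μ α β = ψ β - ψ α) (α β : ℕ) :
    massFlow g μ α β = μ.real {α} * μ.real {β} * (ψ β - ψ α) := by
  by_cases h : μ.real {α} * μ.real {β} = 0
  · rw [massFlow_of_mul_eq_zero μ h, h1 _ _ h, h, zero_mul]
  · rw [massFlow_eq_mul_balanceA μ h, hψ _ _ h]

theorem PotentialCondition.of_massFlow {μ : Measure ℕ} {u : ℕ → ℝ}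
    (h : ∀ α β, massFlow g μ α β = μ.real {β} * u α - μ.real {α} * u β) :
    PotentialCondition g μ := by
  refine ⟨fun n => -(u n / μ.real {n}), fun α β hne => mul_left_cancel₀ hne ?_⟩
  rw [← massFlow_eq_mul_balanceA μ hne, h]
  have := left_ne_zero_of_mul hne
  have := right_ne_zero_of_mul hne
  field_simp
  ring

/-- Conservation of total probability: the constant function 1 does not change under jumps. -/
theorem hasSum_massFlow (hg : IsRate g) (hgC : BoundedTotalRates g) (μ : Measure ℕ)
    [IsProbabilityMeasure μ] : HasSum (fun q : ℕ × ℕ => massFlow g μ q.1 q.2) 0 := by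
  have := hasSum_massFlow_mul hg hgC μ (F := fun _ _ => 1) (m := 1) (by simp) (s := 0)
    (by simp [hasSum_zero])
  simpa using this

/-- The pairing of the flow of mass with a product of functions of the two occupation numbers. -/
noncomputable def flowPairing (g : ℕ → ℕ → ℕ → ℝ) (μ : Measure ℕ) (φ χ : ℕ → ℝ) : ℝ :=
  ∑' q : ℕ × ℕ, massFlow g μ q.1 q.2 * (φ q.1 * χ q.2)

theorem hasSum_flowPairing (hg : IsRate g) (hgC : BoundedTotalRates g) (μ : Measure ℕ)
    [IsProbabilityMeasure μ] {φ χ : ℕ → ℝ} {m m' : ℝ} (hφ : ∀ n, |φ n| ≤ m)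
    (hχ : ∀ n, |χ n| ≤ m') :
    HasSum (fun q : ℕ × ℕ => massFlow g μ q.1 q.2 * (φ q.1 * χ q.2)) (flowPairing g μ φ χ) := by
  refine Summable.hasSum (Summable.of_norm_bounded
    ((hasSum_massFlow hg hgC μ).summable.abs.mul_right (m * m')) fun q => ?_)
  have h1 := hφ q.1
  have h2 := hχ q.2
  have hm : 0 ≤ m := (abs_nonneg _).trans h1
  rw [Real.norm_eq_abs, abs_mul, abs_mul]
  gcongr

theorem abs_single_le (α n : ℕ) : |(Pi.single α 1 : ℕ → ℝ) n| ≤ 1 := by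
  by_cases h : n = α
  · simp [h]
  · simp [h]

/-- The indicator of `α`, centered under `μ`. -/
noncomputable def centeredIndicator (μ : Measure ℕ) (α n : ℕ) : ℝ :=
  (Pi.single α 1 : ℕ → ℝ) n - μ.real {α}

theorem abs_centeredIndicator_le (μ : Measure ℕ) [IsProbabilityMeasure μ] (α n : ℕ) :
    |centeredIndicator μ α n| ≤ 2 := by
  have h1 := abs_single_le α n
  have h2 : μ.real {α} ≤ 1 := measureReal_le_one
  have h3 : 0 ≤ μ.real {α} := measureReal_nonneg
  rw [centeredIndicator, abs_le] at *
  constructor <;> linarith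

theorem integral_centeredIndicator (μ : Measure ℕ) [IsProbabilityMeasure μ] (α : ℕ) :
    ∫ n, centeredIndicator μ α n ∂μ = 0 := by
  have h : (Pi.single α 1 : ℕ → ℝ) = ({α} : Set ℕ).indicator 1 := by
    ext n
    simp [Pi.single_apply, Set.indicator_apply]
  simp only [centeredIndicator]
  rw [integral_sub (Integrable.of_bound Measurable.of_discrete.aestronglyMeasurable 1
    (ae_of_all _ (abs_single_le α))) (integrable_const _), h,
    integral_indicator_one (measurableSet_singleton α)]
  simp

/-- Expand the product; pairings with the constant 1 are the marginals of the flow, and the constant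
term drops out because the total flow is zero. -/
theorem flowPairing_centeredIndicator (hg : IsRate g) (hgC : BoundedTotalRates g) (μ : Measure ℕ)
    [IsProbabilityMeasure μ] (α β : ℕ) :
    flowPairing g μ (centeredIndicator μ α) (centeredIndicator μ β) =
      massFlow g μ α β - μ.real {β} * flowPairing g μ (Pi.single α 1) 1 -
        μ.real {α} * flowPairing g μ 1 (Pi.single β 1) := by
  have one : ∀ n, |(1 : ℕ → ℝ) n| ≤ 1 := by simp
  have h1 := hasSum_flowPairing hg hgC μ (abs_single_le α) one
  have h2 := hasSum_flowPairing hg hgC μ one (abs_single_le β)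
  have h3 := hasSum_massFlow hg hgC μ
  have h4 : HasSum (fun q : ℕ × ℕ => massFlow g μ q.1 q.2 *
      ((Pi.single α 1 : ℕ → ℝ) q.1 * (Pi.single β 1 : ℕ → ℝ) q.2)) (massFlow g μ α β) := by
    convert hasSum_single (α, β) fun q hq => ?_ using 1
    · simp
    · rcases q with ⟨a, b⟩
      by_cases ha : a = α
      · have hb : b ≠ β := fun hb => hq (by rw [ha, hb])
        simp [hb]
      · simp [ha]
  have h5 := ((h4.sub (h1.mul_left (μ.real {β}))).sub (h2.mul_left (μ.real {α}))).add
    (h3.mul_left (μ.real {α} * μ.real {β}))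
  rw [mul_zero, add_zero] at h5
  refine HasSum.tsum_eq (h5.congr_fun fun q => ?_)
  simp only [centeredIndicator, Pi.one_apply]
  ring

end Balance

/-! ### Necessity, by one-site and two-site test functions. -/

section Necessity

variable {d : ℕ} {p : Site d → Site d → ℝ} {g : ℕ → ℕ → ℕ → ℝ}

theorem dependsOn_mul_eval (φ χ : ℕ → ℝ) (x y : Site d) :
    DependsOn (fun η : Config d => φ (η x) * χ (η y)) (({x, y} : Finset (Site d)) : Set (Site d)) := by
  intro η ζ h
  have hx : η x = ζ x := h x (by simp)
  have hy : η y = ζ y := h y (by simp)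
  simp only [hx, hy]

theorem isBoundedCylinder_mul_eval {φ χ : ℕ → ℝ} {m m' : ℝ} (hφ : ∀ n, |φ n| ≤ m)
    (hχ : ∀ n, |χ n| ≤ m') (x y : Site d) :
    IsBoundedCylinder (fun η : Config d => φ (η x) * χ (η y)) := by
  refine ⟨⟨m * m', fun η => ?_⟩, _, dependsOn_mul_eval φ χ x y⟩
  rw [abs_mul]
  exact mul_le_mul (hφ _) (hχ _) (abs_nonneg _) ((abs_nonneg _).trans (hφ 0))

theorem integral_jumpTerm_mul_eval (hg : IsRate g) (hgC : BoundedTotalRates g) (μ : Measure ℕ)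
    [IsProbabilityMeasure μ] {φ χ : ℕ → ℝ} {m m' : ℝ} (hφ : ∀ n, |φ n| ≤ m)
    (hχ : ∀ n, |χ n| ≤ m') {x y : Site d} (hxy : x ≠ y) :
    ∫ η, jumpTerm g (fun η => φ (η x) * χ (η y)) x y η ∂(productMeasure d μ) =
      flowPairing g μ φ χ := by
  have h := hasSum_integral_jumpTerm hg hgC μ (isBoundedCylinder_mul_eval hφ hχ x y) hxy
  rw [flowPairing, ← h.tsum_eq]
  simp [pairMean, hxy]

/-- The jump does not touch `x`. If it touches `y`, then φ(η(x)) remains an independent factor of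
mean zero; if not, the jump term is zero. -/
theorem integral_jumpTerm_of_centered (hg : IsRate g) (hgC : BoundedTotalRates g) (μ : Measure ℕ)
    [IsProbabilityMeasure μ] {φ χ : ℕ → ℝ} {m m' : ℝ} (hφ : ∀ n, |φ n| ≤ m)
    (hχ : ∀ n, |χ n| ≤ m') (hφ0 : ∫ n, φ n ∂μ = 0) {x y u v : Site d} (hxu : x ≠ u)
    (hxv : x ≠ v) :
    ∫ η, jumpTerm g (fun η => φ (η x) * χ (η y)) u v η ∂(productMeasure d μ) = 0 := by
  by_cases huv : u = v
  · subst huv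
    simp [jumpTerm_self]
  by_cases hy : y = u ∨ y = v
  · have h := hasSum_integral_jumpTerm hg hgC μ (isBoundedCylinder_mul_eval hφ hχ x y) huv
    refine h.unique (hasSum_zero.congr_fun fun q => ?_)
    rw [pairMean]
    simp only [Function.update_of_ne hxu, Function.update_of_ne hxv]
    rcases hy with rfl | rfl
    · simp only [Function.update_of_ne huv, Function.update_self]
      rw [integral_mul_const, integral_eval, hφ0, zero_mul, mul_zero]
    · simp only [Function.update_self]
      rw [integral_mul_const, integral_eval, hφ0, zero_mul, mul_zero]
  · push Not at hy
    have h0 : ∀ η, jumpTerm g (fun η : Config d => φ (η x) * χ (η y)) u v η = 0 :=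
      jumpTerm_eq_zero (dependsOn_mul_eval φ χ x y)
        (by simp [hxu.symm, hy.1.symm]) (by simp [hxv.symm, hy.2.symm])
    simp [h0]

theorem flowPairing_centered_of_integral_zero (hp : IsTransition p) (hg : IsRate g)
    (hgC : BoundedTotalRates g) (μ : Measure ℕ) [IsProbabilityMeasure μ]
    (hz : GeneratorIntegralZero p g (productMeasure d μ)) {φ χ : ℕ → ℝ} {m m' : ℝ}
    (hφ : ∀ n, |φ n| ≤ m) (hχ : ∀ n, |χ n| ≤ m') (hφ0 : ∫ n, φ n ∂μ = 0) (hχ0 : ∫ n, χ n ∂μ = 0)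
    {x y : Site d} (hxy : x ≠ y) :
    p x y * flowPairing g μ φ χ + p y x * flowPairing g μ χ φ = 0 := by
  have hf := isBoundedCylinder_mul_eval hφ hχ x y
  have hcomm : (fun η : Config d => φ (η x) * χ (η y)) = fun η => χ (η y) * φ (η x) := by
    simp only [mul_comm]
  have h := hasSum_integral_generator hp hg hgC μ hf
  rw [hz _ hf] at h
  have h2 := h.unique (hasSum_sum_of_ne_finset_zero (s := {(x, y), (y, x)}) ?_)
  · rw [Finset.sum_pair (by simp [hxy])] at h2
    rw [integral_jumpTerm_mul_eval hg hgC μ hφ hχ hxy, hcomm,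
      integral_jumpTerm_mul_eval hg hgC μ hχ hφ hxy.symm] at h2
    exact h2.symm
  · rintro ⟨u, v⟩ huv
    simp only [Finset.mem_insert, Finset.mem_singleton, Prod.mk.injEq, not_or, not_and] at huv
    by_cases hx : x = u ∨ x = v
    · by_cases hy : y = u ∨ y = v
      · exfalso
        rcases hx with rfl | rfl <;> rcases hy with rfl | rfl
        · exact hxy rfl
        · exact huv.1 rfl rfl
        · exact huv.2 rfl rfl
        · exact hxy rfl
      · push Not at hy
        simp only
        rw [hcomm, integral_jumpTerm_of_centered hg hgC μ hχ hφ hχ0 hy.1 hy.2, mul_zero]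
    · push Not at hx
      simp only
      rw [integral_jumpTerm_of_centered hg hgC μ hφ hχ hφ0 hx.1 hx.2, mul_zero]

/-- With the test function φ(η(x)), edges leaving `x` contribute one marginal pairing and edges
entering `x` the other, each with total weight 1 - p(x,x) > 0. -/
theorem flowPairing_one_of_integral_zero (hp : IsTransition p) (hg : IsRate g)
    (hgC : BoundedTotalRates g) (μ : Measure ℕ) [IsProbabilityMeasure μ]
    (hz : GeneratorIntegralZero p g (productMeasure d μ)) {x y : Site d} (hxy : x ≠ y)
    (hpos : 0 < p x y) {φ : ℕ → ℝ} {m : ℝ} (hφ : ∀ n, |φ n| ≤ m) :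
    flowPairing g μ φ 1 + flowPairing g μ 1 φ = 0 := by
  have one : ∀ n, |(1 : ℕ → ℝ) n| ≤ 1 := by simp
  have hl : ∀ v, (fun η : Config d => φ (η x) * (1 : ℕ → ℝ) (η v)) = fun η => φ (η x) := by simp
  have hr : ∀ v, (fun η : Config d => (1 : ℕ → ℝ) (η v) * φ (η x)) = fun η => φ (η x) := by simp
  have hf : IsBoundedCylinder fun η : Config d => φ (η x) :=
    hl x ▸ isBoundedCylinder_mul_eval hφ one x x
  have hV : DependsOn (fun η : Config d => φ (η x)) (({x} : Finset (Site d)) : Set (Site d)) :=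
    fun η ζ h => congrArg φ (h x (by simp))
  have h := hasSum_integral_generator hp hg hgC μ hf
  rw [hz _ hf] at h
  have hind : ∀ z ∉ ({x} : Finset (Site d)), (Pi.single x 1 : Site d → ℝ) z = 0 := fun z hz => by
    rw [Pi.single_eq_of_ne (by simpa using hz)]
  have h1 := (hp.hasSum_mul_fst hind).mul_right (flowPairing g μ φ 1)
  have h2 := (hp.hasSum_mul_snd hind).mul_right (flowPairing g μ 1 φ)
  -- The row and the column of `x` both include the loop (x,x), which moves nothing; this term
  -- removes it.
  have h3 := hasSum_ite_eq (x, x) (p x x * (flowPairing g μ φ 1 + flowPairing g μ 1 φ))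
  have h4 := h.unique (((h1.add h2).sub h3).congr_fun ?_)
  · simp only [Finset.sum_singleton, Pi.single_eq_same] at h4
    have := hp.diag_lt_one hxy hpos
    have h5 : (1 - p x x) * (flowPairing g μ φ 1 + flowPairing g μ 1 φ) = 0 := by linarith
    exact (mul_eq_zero.1 h5).resolve_left (by linarith)
  · rintro ⟨u, v⟩
    by_cases hu : u = x
    · subst hu
      by_cases hv : v = u
      · subst hv
        simp [jumpTerm_self]
        ring
      · have := integral_jumpTerm_mul_eval (d := d) hg hgC μ hφ one (Ne.symm hv)
        rw [hl] at this
        simp [this, hv]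
    · by_cases hv : v = x
      · subst hv
        have := integral_jumpTerm_mul_eval (d := d) hg hgC μ one hφ hu
        rw [hr] at this
        simp [this, hu]
      · have h0 := jumpTerm_eq_zero (g := g) hV (x := u) (y := v) (by simpa) (by simpa)
        simp [h0, hu, hv]

/-- If the generator integrates to zero, the flow of mass is the sum of an antisymmetric part of
potential form and a part that is balanced against the transition probabilities. -/
theorem exists_massFlow_decomposition (hd : 1 ≤ d) (hp : IsTransition p) (hg : IsRate g)
    (hgC : BoundedTotalRates g) (μ : Measure ℕ) [IsProbabilityMeasure μ]
    (hz : GeneratorIntegralZero p g (productMeasure d μ)) :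
    ∃ (D : ℕ → ℕ → ℝ) (u : ℕ → ℝ),
      (∀ α β, massFlow g μ α β = D α β + μ.real {β} * u α - μ.real {α} * u β) ∧
      ∀ (x y : Site d), x ≠ y → ∀ α β, p x y * D α β + p y x * D β α = 0 := by
  obtain ⟨x, y, hxy, hpos⟩ := hp.exists_pos_of_ne hd
  refine ⟨fun α β => flowPairing g μ (centeredIndicator μ α) (centeredIndicator μ β),
    fun α => flowPairing g μ (Pi.single α 1) 1, fun α β => ?_, fun x y hxy α β => ?_⟩
  · have h := flowPairing_one_of_integral_zero hp hg hgC μ hz hxy hpos (abs_single_le β)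
    simp only [flowPairing_centeredIndicator hg hgC, eq_neg_of_add_eq_zero_right h]
    ring
  · exact flowPairing_centered_of_integral_zero hp hg hgC μ hz (abs_centeredIndicator_le μ α)
      (abs_centeredIndicator_le μ β) (integral_centeredIndicator μ α)
      (integral_centeredIndicator μ β) hxy

theorem massFlow_antisymm_of_integral_zero (hd : 1 ≤ d) (hp : IsTransition p) (hg : IsRate g)
    (hgC : BoundedTotalRates g) (μ : Measure ℕ) [IsProbabilityMeasure μ]
    (hz : GeneratorIntegralZero p g (productMeasure d μ)) (α β : ℕ) :
    massFlow g μ α β = -massFlow g μ β α := by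
  obtain ⟨D, u, hD, hpD⟩ := exists_massFlow_decomposition hd hp hg hgC μ hz
  obtain ⟨x, y, hxy, hpos⟩ := hp.exists_pos_of_ne hd
  have h1 := hpD x y hxy α β
  have h2 := hpD x y hxy β α
  have h3 : (p x y + p y x) * (D α β + D β α) = 0 := by linarith
  have h4 := (mul_eq_zero.1 h3).resolve_left (by linarith [hp.nonneg y x])
  rw [hD, hD]
  linarith

/-- At a pair with p(x,y) ≠ p(y,x), the relations for (α,β) and (β,α) form a nonsingular linear
system, so the doubly centered part vanishes. -/
theorem potentialCondition_of_integral_zero (hd : 1 ≤ d) (hp : IsTransition p) (hg : IsRate g)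
    (hgC : BoundedTotalRates g) (μ : Measure ℕ) [IsProbabilityMeasure μ]
    (hz : GeneratorIntegralZero p g (productMeasure d μ)) (hns : ¬ IsSymmetricTransition p) :
    PotentialCondition g μ := by
  obtain ⟨D, u, hD, hpD⟩ := exists_massFlow_decomposition hd hp hg hgC μ hz
  simp only [IsSymmetricTransition, not_forall] at hns
  obtain ⟨x, y, hne⟩ := hns
  have hxy : x ≠ y := fun h => hne (by rw [h])
  refine PotentialCondition.of_massFlow (u := u) fun α β => ?_
  have h1 := hpD x y hxy α β
  have h2 := hpD x y hxy β α
  have hsum : p x y + p y x ≠ 0 := fun h => hne (by linarith [hp.nonneg x y, hp.nonneg y x])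
  have h3 : (p x y + p y x) * (D α β + D β α) = 0 := by linarith
  have h4 := (mul_eq_zero.1 h3).resolve_left hsum
  have h5 : (p x y - p y x) * D α β = 0 := by
    rw [eq_neg_of_add_eq_zero_right h4] at h1
    linarith
  rw [hD, (mul_eq_zero.1 h5).resolve_left (sub_ne_zero.2 hne), zero_add]

end Necessity

/-! ### Sufficiency, by symmetry or by double stochasticity. -/

section Sufficiency

variable {d : ℕ} {p : Site d → Site d → ℝ} {g : ℕ → ℕ → ℕ → ℝ}

theorem generatorIntegralZero_of_symmetric (hp : IsTransition p) (hsymm : IsSymmetricTransition p)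
    (hg : IsRate g) (hgC : BoundedTotalRates g) (μ : Measure ℕ) [IsProbabilityMeasure μ]
    (hanti : ∀ α β, massFlow g μ α β = -massFlow g μ β α) :
    GeneratorIntegralZero p g (productMeasure d μ) := by
  intro f hf
  have h := hasSum_integral_generator hp hg hgC μ hf
  have hflip : ∀ x y, ∫ η, jumpTerm g f y x η ∂(productMeasure d μ) =
      -∫ η, jumpTerm g f x y η ∂(productMeasure d μ) := by
    intro x y
    by_cases hxy : x = y
    · subst hxy
      simp [jumpTerm_self]
    · have h1 := (Equiv.prodComm ℕ ℕ).hasSum_iff.2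
        (hasSum_integral_jumpTerm hg hgC μ hf (Ne.symm hxy))
      refine h1.unique ((hasSum_integral_jumpTerm hg hgC μ hf hxy).neg.congr_fun fun q => ?_)
      simp only [Function.comp_apply, Equiv.prodComm_apply, Prod.fst_swap, Prod.snd_swap]
      rw [pairMean_swap μ f hxy, hanti, neg_mul]
  have h2 := ((Equiv.prodComm (Site d) (Site d)).hasSum_iff.2 h).unique (h.neg.congr_fun
    fun e => by
      simp only [Function.comp_apply, Equiv.prodComm_apply, Prod.fst_swap, Prod.snd_swap]
      rw [hflip, hsymm e.2 e.1, mul_neg])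
  linarith

theorem integrable_of_summable_real (μ : Measure ℕ) [IsProbabilityMeasure μ] {ψ : ℕ → ℝ}
    (h : Summable fun n => μ.real {n} * ψ n) : Integrable ψ μ := by
  rw [← Measure.sum_smul_dirac μ]
  refine integrable_sum_dirac (fun n => measure_ne_top _ _) ?_
  refine h.abs.congr fun n => ?_
  rw [abs_mul, abs_of_nonneg measureReal_nonneg]
  rfl

theorem exists_real_singleton_ne_zero (μ : Measure ℕ) [IsProbabilityMeasure μ] :
    ∃ n, μ.real {n} ≠ 0 := by
  by_contra! hcon
  have h0 : μ Set.univ = 0 := by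
    rw [← Set.iUnion_of_singleton ℕ]
    exact measure_iUnion_null fun n => (measureReal_eq_zero_iff).1 (hcon n)
  simp at h0

/-- In a row `n` with μ(n) ≠ 0 the flow is summable, and it equals μ(n)μ(k)(ψ(k) - ψ(n)); solving
for μ(k)ψ(k) gives integrability without any moment assumption. -/
theorem integrable_potential (hg : IsRate g) (hgC : BoundedTotalRates g) (μ : Measure ℕ)
    [IsProbabilityMeasure μ] {ψ : ℕ → ℝ}
    (hψ : ∀ α β, massFlow g μ α β = μ.real {α} * μ.real {β} * (ψ β - ψ α)) :
    Integrable ψ μ := by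
  obtain ⟨n, hn⟩ := exists_real_singleton_ne_zero μ
  have h1 := (hasSum_massFlow hg hgC μ).summable.prod_factor n
  have h2 := summable_real_mul_real μ |>.prod_factor n
  refine integrable_of_summable_real μ ((h1.add (h2.mul_right (ψ n))).mul_left (μ.real {n})⁻¹
    |>.congr fun k => ?_)
  simp only [hψ]
  field_simp
  ring

theorem integrable_mul_eval (μ : Measure ℕ) [IsProbabilityMeasure μ] {ψ : ℕ → ℝ}
    (hψ : Integrable ψ μ) {f : Config d → ℝ} (hf : IsBoundedCylinder f) (x : Site d) :
    Integrable (fun η => f η * ψ (η x)) (productMeasure d μ) := by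
  obtain ⟨m, hm⟩ := hf.1
  exact ((measurePreserving_eval_infinitePi (fun _ : Site d => μ) x).integrable_comp_of_integrable
    hψ).bdd_mul hf.measurable.aestronglyMeasurable (ae_of_all _ hm)

theorem integral_mul_eval_of_notMem (μ : Measure ℕ) [IsProbabilityMeasure μ] {ψ : ℕ → ℝ}
    (hψ : Integrable ψ μ) {f : Config d → ℝ} (hf : IsBoundedCylinder f) {V : Finset (Site d)}
    (hV : DependsOn f (V : Set (Site d))) {x : Site d} (hx : x ∉ V) :
    ∫ η, f η * ψ (η x) ∂(productMeasure d μ) =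
      (∫ n, ψ n ∂μ) * ∫ η, f η ∂(productMeasure d μ) := by
  have h := measurePreserving_update μ x
  have hi := integrable_mul_eval μ hψ hf x
  rw [← integral_prod_mul ψ f]
  conv_lhs => rw [← h.map_eq]
  rw [← h.map_eq] at hi
  rw [integral_map h.measurable.aemeasurable hi.aestronglyMeasurable]
  refine integral_congr_ae (ae_of_all _ fun q => ?_)
  simp only [Function.update_self]
  rw [hV (x := Function.update q.2 x q.1) (y := q.2) fun z hz =>
    Function.update_of_ne (ne_of_mem_of_not_mem hz hx) _ _, mul_comm]

theorem integral_jumpTerm_of_potential (hg : IsRate g) (hgC : BoundedTotalRates g) (μ : Measure ℕ)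
    [IsProbabilityMeasure μ] {ψ : ℕ → ℝ}
    (hψ : ∀ α β, massFlow g μ α β = μ.real {α} * μ.real {β} * (ψ β - ψ α)) {f : Config d → ℝ}
    (hf : IsBoundedCylinder f) (x y : Site d) :
    ∫ η, jumpTerm g f x y η ∂(productMeasure d μ) =
      ∫ η, f η * ψ (η y) ∂(productMeasure d μ) - ∫ η, f η * ψ (η x) ∂(productMeasure d μ) := by
  by_cases hxy : x = y
  · subst hxy
    simp [jumpTerm_self]
  have hi := integrable_mul_eval μ (integrable_potential hg hgC μ hψ) hf
  refine (hasSum_integral_jumpTerm hg hgC μ hf hxy).unique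
    (((hasSum_pairMean μ (hi y) x y).sub (hasSum_pairMean μ (hi x) x y)).congr_fun fun q => ?_)
  simp only [pairMean, Function.update_self, Function.update_of_ne hxy, integral_mul_const, hψ]
  ring

theorem generatorIntegralZero_of_potential (hp : IsTransition p) (hg : IsRate g)
    (hgC : BoundedTotalRates g) (μ : Measure ℕ) [IsProbabilityMeasure μ] {ψ : ℕ → ℝ}
    (hψ : ∀ α β, massFlow g μ α β = μ.real {α} * μ.real {β} * (ψ β - ψ α)) :
    GeneratorIntegralZero p g (productMeasure d μ) := by
  intro f hf
  obtain ⟨V, hV⟩ := hf.2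
  have hψi := integrable_potential hg hgC μ hψ
  -- Subtracting the value taken off `V`, by independence, makes `h` finitely supported and leaves
  -- h(y) - h(x) unchanged.
  let h : Site d → ℝ := fun x => ∫ η, f η * ψ (η x) ∂(productMeasure d μ) -
    (∫ n, ψ n ∂μ) * ∫ η, f η ∂(productMeasure d μ)
  have h0 : ∀ x ∉ V, h x = 0 := fun x hx =>
    sub_eq_zero.2 (integral_mul_eval_of_notMem μ hψi hf hV hx)
  refine (hasSum_integral_generator hp hg hgC μ hf).unique ?_
  rw [← sub_self (∑ x ∈ V, h x)]
  refine ((hp.hasSum_mul_snd h0).sub (hp.hasSum_mul_fst h0)).congr_fun fun e => ?_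
  rw [integral_jumpTerm_of_potential hg hgC μ hψ hf]
  simp only [h]
  ring

end Sufficiency

theorem corollary3p4 (d : ℕ) (hd : 1 ≤ d)
    (p : Site d → Site d → ℝ) (hp : IsTransition p)
    (a : Site d → ℝ) (ha : IsWeight p a)
    (g : ℕ → ℕ → ℕ → ℝ) (hg : IsRate g) (hgC : BoundedTotalRates g)
    (S : MigrationSemigroup p g)
    (μ : Measure ℕ) [IsProbabilityMeasure μ]
    (hinv : S.IsInvariant a (Measure.infinitePi fun _ : Site d => μ) ↔
      GeneratorIntegralZero p g (Measure.infinitePi fun _ : Site d => μ)) :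
    (S.IsInvariant a (Measure.infinitePi fun _ : Site d => μ) →
      NoExitCondition g μ ∧ AntisymmetryCondition g μ) ∧
    (IsSymmetricTransition p →
      (S.IsInvariant a (Measure.infinitePi fun _ : Site d => μ) ↔
        NoExitCondition g μ ∧ AntisymmetryCondition g μ)) ∧
    (¬ IsSymmetricTransition p →
      (S.IsInvariant a (Measure.infinitePi fun _ : Site d => μ) ↔
        NoExitCondition g μ ∧ PotentialCondition g μ)) := by
  rw [hinv]
  have hnec : GeneratorIntegralZero p g (Measure.infinitePi fun _ : Site d => μ) →
      NoExitCondition g μ ∧ AntisymmetryCondition g μ := fun hz =>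
    (noExit_and_antisymmetry_iff hg μ).2 (massFlow_antisymm_of_integral_zero hd hp hg hgC μ hz)
  refine ⟨hnec, fun hsymm => ⟨hnec, fun h => ?_⟩, fun hns => ⟨fun hz => ⟨(hnec hz).1, ?_⟩, ?_⟩⟩
  · exact generatorIntegralZero_of_symmetric hp hsymm hg hgC μ
      ((noExit_and_antisymmetry_iff hg μ).1 h)
  · exact potentialCondition_of_integral_zero hd hp hg hgC μ hz hns
  · rintro ⟨h1, ψ, hψ⟩
    exact generatorIntegralZero_of_potential hp hg hgC μ (massFlow_eq_of_potential h1 hψ)
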